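/- Let $\mathcal S=(A,X,Y,(\alpha_i)_{i\in I},(\alpha_i^\vee)_{i\in I})$ be a Kac--Moody root datum: $I$ is a finite set; $A=(a_{i,j})_{i,j\in I}$ is an integer matrix with $a_{i,i}=2$, with $a_{i,j}\le 0$ for $i\ne j$, and with $a_{i,j}=0\Leftrightarrow a_{j,i}=0$; $X$ and $Y$ are free $\mathbb Z$-modules of finite rank in perfect duality; and $(\alpha_i)_{i\in I}$ in $X$ and $(\alpha_i^\vee)_{i\in I}$ in $Y$ are $\mathbb Z$-linearly independent families with $\alpha_j(\alpha_i^\vee)=a_{i,j}$ for all $i,j\in I$. Let $\mathbb A=Y\otimes_{\mathbb Z}\mathbb R$, regard each $\alpha_i$ as a linear form on $\mathbb A$, and let $W_0\subset \mathrm{GL}(\mathbb A)$ be the Weyl group, generated by the reflections $r_i(v)=v-\alpha_i(v)\alpha_i^\vee$, $i\in I$. Let $\overline{C^v_f}=\{v\in\mathbb A\mid \alpha_i(v)\ge 0\ \forall i\in I\}$ be the closed fundamental chamber and $\mathcal T=\bigcup_{w\in W_0}w\cdot\overline{C^v_f}$ the Tits cone. For a nonempty $E\subset\mathbb A$, let $W_{0,E}$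 be the pointwise fixator of $E$ in $W_0$, and write $W_{0,\lambda}=W_{0,\{\lambda\}}$. For $\lambda\neq\lambda'$ in $\mathbb A$, let $[\lambda,\lambda']$ and $]\lambda,\lambda'[$ denote the closed and the open segment with endpoints $\lambda,\lambda'$. 1. Let $\lambda,\nu\in\mathcal T$ with $\lambda\ne\nu$. Then $W_{0,\nu}/(W_{0,\lambda}\cap W_{0,\nu})$ is finite if and only if there exists $\lambda'\in\mathcal T$ such that $\nu\in\,]\lambda,\lambda'[$. 2. Let $\lambda,\lambda'\in\mathcal T$ with $\lambda\ne\lambda'$, let $\nu\in\,]\lambda,\lambda'[$, and let $E\subset W_0$ be such that $E\cdot\nu=\{w(\nu)\mid w\in E\}$ is finite. Then $W_{0,\nu}/W_{0,[\lambda,\lambda']}$ is finite and $$|E\cdot\lambda|\le |E\cdot\nu|\cdot|W_{0,\nu}/W_{0,[\lambda,\lambda']}|.$$ In particular, $E\cdot\lambda$ is finite. -/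

import Mathlib

open scoped TensorProduct

/-- A Kac-Moody matrix (generalized Cartan matrix) indexed by `I`. -/
structure IsKacMoodyMatrix {I : Type*} (A : Matrix I I ℤ) : Prop where
  diag : ∀ i, A i i = 2
  off_diag : ∀ i j, i ≠ j → A i j ≤ 0
  zero_iff : ∀ i j, A i j = 0 ↔ A j i = 0

/-- A Kac-Moody root datum `(A, X, Y, (α_i), (α_i^∨))`, where `X` and `Y` are free `ℤ`-modules of
finite rank in duality and `I` is the finite index set of the simple roots. -/
structure KacMoodyRootDatum (I X Y : Type*) [Finite I]
    [AddCommGroup X] [Module.Free ℤ X] [Module.Finite ℤ X]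
    [AddCommGroup Y] [Module.Free ℤ Y] [Module.Finite ℤ Y] where
  /-- the Kac-Moody matrix -/
  A : Matrix I I ℤ
  isKacMoodyMatrix : IsKacMoodyMatrix A
  /-- the duality between characters and cocharacters -/
  pairing : X →ₗ[ℤ] Y →ₗ[ℤ] ℤ
  isPerfPair : pairing.IsPerfPair
  /-- the simple roots -/
  root : I → X
  /-- the simple coroots -/
  coroot : I → Y
  linearIndependent_root : LinearIndependent ℤ root
  linearIndependent_coroot : LinearIndependent ℤ coroot
  pairing_root_coroot : ∀ i j, pairing (root j) (coroot i) = A i j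

namespace KacMoodyRootDatum

variable {I X Y : Type*} [Finite I]
  [AddCommGroup X] [Module.Free ℤ X] [Module.Finite ℤ X]
  [AddCommGroup Y] [Module.Free ℤ Y] [Module.Finite ℤ Y]

/-- The real vector space `𝔸 = Y ⊗ ℝ`. -/
abbrev Apartment (_S : KacMoodyRootDatum I X Y) : Type _ := ℝ ⊗[ℤ] Y

variable (S : KacMoodyRootDatum I X Y)

/-- The linear form on `𝔸` induced by a character `x`: it sends `c ⊗ y` to `c * ⟨x, y⟩`. -/
noncomputable def form (x : X) : S.Apartment →ₗ[ℝ] ℝ :=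
  (TensorProduct.AlgebraTensorModule.rid ℤ ℝ ℝ).toLinearMap ∘ₗ (S.pairing x).baseChange ℝ

/-- The simple root `α_i`, as a linear form on `𝔸`. -/
noncomputable def simpleRoot (i : I) : S.Apartment →ₗ[ℝ] ℝ := S.form (S.root i)

/-- The simple coroot `α_i^∨`, as an element of `𝔸`. -/
noncomputable def simpleCoroot (i : I) : S.Apartment := 1 ⊗ₜ[ℤ] S.coroot i

theorem form_tmul (x : X) (c : ℝ) (y : Y) :
    S.form x (c ⊗ₜ[ℤ] y) = (S.pairing x y : ℝ) * c := by
  simp [form]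

theorem simpleRoot_simpleCoroot_self (i : I) : S.simpleRoot i (S.simpleCoroot i) = 2 := by
  simp [simpleRoot, simpleCoroot, form_tmul, S.pairing_root_coroot, S.isKacMoodyMatrix.diag]

/-- The simple reflection `r_i : v ↦ v - α_i(v) α_i^∨`. -/
noncomputable def simpleReflection (i : I) : S.Apartment ≃ₗ[ℝ] S.Apartment :=
  Module.reflection (S.simpleRoot_simpleCoroot_self i)

/-- The Weyl group `W₀`, the subgroup of `GL(𝔸)` generated by the simple reflections. -/
noncomputable def weylGroup : Subgroup (S.Apartment ≃ₗ[ℝ] S.Apartment) :=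
  Subgroup.closure (Set.range S.simpleReflection)

/-- The (open) fundamental chamber. -/
def chamber : Set S.Apartment := {v | ∀ i, 0 < S.simpleRoot i v}

/-- The closed fundamental chamber; see `closure_chamber`. -/
def closedChamber : Set S.Apartment := {v | ∀ i, 0 ≤ S.simpleRoot i v}

/-- The Tits cone, the union of the Weyl group translates of the closed fundamental chamber. -/
def titsCone : Set S.Apartment :=
  ⋃ w : S.weylGroup, (fun v : S.Apartment => w • v) '' S.closedChamber

/-- The (pointwise) fixator `W_{0,E}` of a subset `E` of `𝔸` in the Weyl group. -/
noncomputable def fixator (E : Set S.Apartment) : Subgroup S.weylGroup :=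
  fixingSubgroup S.weylGroup E

theorem mem_fixator (E : Set S.Apartment) (w : S.weylGroup) :
    w ∈ S.fixator E ↔ ∀ v ∈ E, (w : S.Apartment ≃ₗ[ℝ] S.Apartment) v = v :=
  mem_fixingSubgroup_iff _

theorem linearIndependent_simpleRoot : LinearIndependent ℝ S.simpleRoot := by
  have h0 : LinearIndependent ℤ fun i => S.pairing (S.root i) :=
    S.linearIndependent_root.map' S.pairing
      (LinearMap.ker_eq_bot.2 S.isPerfPair.bijective_left.injective)
  have h1 := Module.Flat.linearIndependent_one_tmul (S := ℝ) h0
  have ibc := TensorProduct.isBaseChange ℤ Y ℝ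
  have h2 := h1.map' ibc.toDualBaseChange.toLinearMap (LinearEquiv.ker _)
  have key : S.simpleRoot =
      ibc.toDualBaseChange.toLinearMap ∘ fun i => 1 ⊗ₜ[ℤ] S.pairing (S.root i) := by
    funext i
    refine TensorProduct.AlgebraTensorModule.curry_injective ?_
    ext y
    have := ibc.toDualBaseChange_tmul 1 (S.pairing (S.root i)) y
    simp only [TensorProduct.mk_apply, one_mul] at this
    simp [simpleRoot, form_tmul, this]
  rw [key]
  exact h2

theorem chamber_nonempty : S.chamber.Nonempty := by
  have hli := S.linearIndependent_simpleRoot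
  obtain ⟨g, hg⟩ := LinearMap.exists_leftInverse_of_injective
    (Finsupp.linearCombination ℝ S.simpleRoot) (LinearMap.ker_eq_bot.2 hli)
  let φ : Module.Dual ℝ (Module.Dual ℝ S.Apartment) :=
    (Finsupp.linearCombination ℝ fun _ : I => (1 : ℝ)) ∘ₗ g
  refine ⟨(Module.evalEquiv ℝ S.Apartment).symm φ, fun i => ?_⟩
  have h1 : g (S.simpleRoot i) = Finsupp.single i 1 := by
    have := LinearMap.congr_fun hg (Finsupp.single i 1)
    simpa using this
  have h2 : S.simpleRoot i ((Module.evalEquiv ℝ S.Apartment).symm φ) = φ (S.simpleRoot i) := by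
    simp
  rw [h2]
  simp [φ, h1]

/-- The closed chamber is the closure of the chamber for the usual topology of the
finite-dimensional real vector space `𝔸`. -/
theorem closure_chamber :
    @closure S.Apartment (moduleTopology ℝ S.Apartment) S.chamber = S.closedChamber := by
  let : TopologicalSpace S.Apartment := moduleTopology ℝ S.Apartment
  have : IsModuleTopology ℝ S.Apartment := ⟨rfl⟩
  have := IsModuleTopology.toContinuousAdd ℝ S.Apartment
  have hc : ∀ i, Continuous (S.simpleRoot i) := fun i =>
    IsModuleTopology.continuous_of_linearMap _
  apply Set.Subset.antisymm
  · refine closure_minimal (fun v hv i => (hv i).le) ?_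
    have : S.closedChamber = ⋂ i, {v | 0 ≤ S.simpleRoot i v} := by
      ext; simp [closedChamber]
    rw [this]
    exact isClosed_iInter fun i => isClosed_le continuous_const (hc i)
  · intro x hx
    obtain ⟨v, hv⟩ := S.chamber_nonempty
    have h1 : Continuous fun t : ℝ => x + t • v := by fun_prop
    have h2 : Filter.Tendsto (fun t : ℝ => x + t • v) (nhdsWithin 0 (Set.Ioi 0)) (nhds x) := by
      have := h1.tendsto 0
      simp only [zero_smul, add_zero] at this
      exact this.mono_left nhdsWithin_le_nhds
    refine mem_closure_of_tendsto h2 ?_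
    filter_upwards [self_mem_nhdsWithin] with t ht i
    have := mul_pos (Set.mem_Ioi.1 ht) (hv i)
    have := hx i
    simp only [map_add, map_smul, smul_eq_mul]
    linarith

end KacMoodyRootDatum

/-! The quotient `W_ν/(W_λ ∩ W_ν)` is the orbit of `λ` under `W_ν`, so the question is when this
orbit is finite. Fix a linear form, the height, equal to 1 on every simple coroot. An element `w`
sends the `j`-th simple coroot to a positive one unless `j` is a right descent
(`rep_coroot_mem_span`). Telescoping gives `w v = v - ∑ α_i(v) ∑ n_ij α_j^∨` with natural `n_ij`
(`exists_rep_eq_sub_sum`), so a dominant point has maximal height in its orbit. Conversely a point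
of maximal height is dominant. Dickson's lemma supplies such maxima, so the Tits cone is convex and
lies in the Tits cone of every standard parabolic subgroup.

Let `ν = sλ + tλ'` be dominant. Its stabilizer is the parabolic subgroup of the simple roots
vanishing at `ν`. For `w` in it, `s wλ + t wλ' = ν`. The height of `wλ'` is bounded above, so that
of `wλ` is bounded below, which leaves finitely many relevant `n_ij`.

Conversely, if the orbit is finite, choose `u` in `W_ν` with `-uλ` of maximal height. Then `ν + e(ν
- uλ)` is dominant for small `e > 0`, and `u⁻¹` carries it to the required endpoint. -/

/-- A family of reflections `v ↦ v - root i v • coroot i` of a real vector space, whose pairings form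
a Kac-Moody matrix. -/
structure ReflectionFamily (ι V : Type*) [AddCommGroup V] [Module ℝ V] where
  /-- the Kac-Moody matrix -/
  A : Matrix ι ι ℤ
  isKacMoodyMatrix : IsKacMoodyMatrix A
  /-- the roots -/
  root : ι → V →ₗ[ℝ] ℝ
  /-- the coroots -/
  coroot : ι → V
  root_coroot : ∀ i j, root j (coroot i) = A i j
  linearIndependent_coroot : LinearIndependent ℝ coroot

/-! ### Rank two arithmetic -/

/-- The order of a product of two distinct simple reflections, as a function of the product of the
two corresponding entries of the Kac-Moody matrix (`0` if the order is infinite). -/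
def coxeterOrder (n : ℤ) : ℕ :=
  if n = 0 then 2 else if n = 1 then 3 else if n = 2 then 4 else if n = 3 then 6 else 0

theorem coxeterOrder_ne_one (n : ℤ) : coxeterOrder n ≠ 1 := by
  unfold coxeterOrder; split_ifs <;> simp

/-- The values of a pair of non-positive integers that vanish together, if their product is less
than four. -/
theorem eq_or_of_nonpos_of_mul_lt_four {p q : ℤ} (hp : p ≤ 0) (hq : q ≤ 0) (h : p = 0 ↔ q = 0)
    (hpq : p * q < 4) :
    (p = 0 ∧ q = 0) ∨ (p = -1 ∧ q = -1) ∨ (p = -1 ∧ q = -2) ∨ (p = -2 ∧ q = -1) ∨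
      (p = -1 ∧ q = -3) ∨ (p = -3 ∧ q = -1) := by
  by_cases hp0 : p = 0
  · exact Or.inl ⟨hp0, h.1 hp0⟩
  have hq0 : q ≠ 0 := fun h' => hp0 (h.2 h')
  have hp1 : p ≤ -1 := by omega
  have hq1 : q ≤ -1 := by omega
  have hp2 : -3 ≤ p := by nlinarith
  have hq2 : -3 ≤ q := by nlinarith
  interval_cases p <;> interval_cases q <;> simp_all

/-- The coordinates of the image of the first coroot of a rank two system under an alternating word
of length `k` that ends with the second index. -/
def alternatingCoeff (a b : ℤ) : ℕ → ℤ × ℤ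
  | 0 => (1, 0)
  | k + 1 =>
    if Even k then ((alternatingCoeff a b k).1, -a * (alternatingCoeff a b k).1 -
      (alternatingCoeff a b k).2)
    else (-b * (alternatingCoeff a b k).2 - (alternatingCoeff a b k).1, (alternatingCoeff a b k).2)

theorem alternatingCoeff_nonneg {a b : ℤ} (ha : a ≤ 0) (hb : b ≤ 0) (h : a = 0 ↔ b = 0) (k : ℕ)
    (hk : coxeterOrder (a * b) = 0 ∨ k < coxeterOrder (a * b)) :
    0 ≤ (alternatingCoeff a b k).1 ∧ 0 ≤ (alternatingCoeff a b k).2 := by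
  by_cases h4 : a * b < 4
  · rcases eq_or_of_nonpos_of_mul_lt_four ha hb h h4 with
      ⟨rfl, rfl⟩ | ⟨rfl, rfl⟩ | ⟨rfl, rfl⟩ | ⟨rfl, rfl⟩ | ⟨rfl, rfl⟩ | ⟨rfl, rfl⟩ <;>
    · norm_num [coxeterOrder] at hk
      interval_cases k <;> decide
  · clear hk
    -- Nonnegativity alone is not inductive. When `ab ≥ 4`, the added bound says that the next
    -- reflection does not decrease the coordinate it changes.
    suffices h : 0 ≤ (alternatingCoeff a b k).1 ∧ 0 ≤ (alternatingCoeff a b k).2 ∧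
        (Even k → -b * (alternatingCoeff a b k).2 ≤ 2 * (alternatingCoeff a b k).1) ∧
        (¬ Even k → -a * (alternatingCoeff a b k).1 ≤ 2 * (alternatingCoeff a b k).2) from
      ⟨h.1, h.2.1⟩
    induction k with
    | zero => simp [alternatingCoeff]
    | succ k ih =>
      obtain ⟨hp, hq, he, ho⟩ := ih
      rw [alternatingCoeff]
      generalize (alternatingCoeff a b k).1 = p at *
      generalize (alternatingCoeff a b k).2 = q at *
      by_cases hke : Even k
      · have he := he hke
        have h1 : 0 ≤ p * (a * b - 4) := mul_nonneg hp (by omega)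
        have h2 : -a * (-b * q) ≤ -a * (2 * p) := mul_le_mul_of_nonneg_left he (by omega)
        have h3 : 0 ≤ q * (a * b - 4) := mul_nonneg hq (by omega)
        simp only [hke, if_true, Nat.even_add_one, not_true, not_false_iff, true_implies,
          false_implies, true_and]
        refine ⟨hp, ?_, ?_⟩ <;> nlinarith
      · have ho := ho hke
        have h1 : 0 ≤ p * (a * b - 4) := mul_nonneg hp (by omega)
        have h2 : -b * (-a * p) ≤ -b * (2 * q) := mul_le_mul_of_nonneg_left ho (by omega)
        have h3 : 0 ≤ q * (a * b - 4) := mul_nonneg hq (by omega)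
        simp only [hke, if_false, Nat.even_add_one, not_true, not_false_iff, true_implies,
          false_implies, and_true]
        refine ⟨?_, hq, ?_⟩ <;> nlinarith

/-! ### The Coxeter group, its action and positivity of coroots -/

namespace ReflectionFamily

variable {ι V : Type*} [AddCommGroup V] [Module ℝ V] (D : ReflectionFamily ι V)

theorem root_coroot_self (i : ι) : D.root i (D.coroot i) = 2 := by
  rw [D.root_coroot, D.isKacMoodyMatrix.diag]; norm_num

/-- The reflection attached to an index. -/
noncomputable def refl (i : ι) : V ≃ₗ[ℝ] V := Module.reflection (D.root_coroot_self i)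

theorem refl_apply (i : ι) (v : V) : D.refl i v = v - D.root i v • D.coroot i :=
  Module.reflection_apply _ _

theorem refl_mul_self (i : ι) : D.refl i * D.refl i = 1 := by
  ext v
  exact Module.involutive_reflection (D.root_coroot_self i) v

open Classical in
/-- The Coxeter matrix of a reflection family. -/
noncomputable def coxeterMatrix : CoxeterMatrix ι where
  M i j := if i = j then 1 else coxeterOrder (D.A i j * D.A j i)
  isSymm := by
    ext i j
    change (if j = i then 1 else coxeterOrder (D.A j i * D.A i j)) = _
    simp only [eq_comm (a := j), mul_comm (D.A j i)]
  diagonal i := by simp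
  off_diagonal i j h := by
    rw [if_neg h]
    exact coxeterOrder_ne_one _

theorem coxeterMatrix_apply {i j : ι} (h : i ≠ j) :
    D.coxeterMatrix i j = coxeterOrder (D.A i j * D.A j i) := by
  classical
  exact if_neg h

/-- If `a_ij a_ji < 4`, six rank two cases remain and each power is computed explicitly; otherwise
the Coxeter order is 0 and the relation is empty. -/
theorem isLiftable_refl : D.coxeterMatrix.IsLiftable D.refl := by
  intro i j
  by_cases hij : i = j
  · subst hij
    rw [CoxeterMatrix.diagonal, pow_one, D.refl_mul_self]
  rw [D.coxeterMatrix_apply hij]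
  by_cases h4 : D.A i j * D.A j i < 4
  · have hi := D.root_coroot_self i
    have hj := D.root_coroot_self j
    have h1 := D.root_coroot i j
    have h2 := D.root_coroot j i
    have key : ∀ v, (D.refl i * D.refl j) v = v + (-D.root i v + D.root j v * D.A j i) • D.coroot i
        - D.root j v • D.coroot j := by
      intro v
      rw [LinearEquiv.mul_apply, D.refl_apply, D.refl_apply]
      simp only [map_sub, map_smul, h2, smul_eq_mul]
      module
    generalize D.refl i * D.refl j = T at key
    rcases eq_or_of_nonpos_of_mul_lt_four (D.isKacMoodyMatrix.off_diag i j hij)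
      (D.isKacMoodyMatrix.off_diag j i (Ne.symm hij)) (D.isKacMoodyMatrix.zero_iff i j) h4 with
      ⟨hp, hq⟩ | ⟨hp, hq⟩ | ⟨hp, hq⟩ | ⟨hp, hq⟩ | ⟨hp, hq⟩ | ⟨hp, hq⟩ <;>
    · rw [hp] at h1
      rw [hq] at h2
      rw [hp, hq]
      ext v
      simp only [hq] at key
      norm_num [coxeterOrder, pow_succ, LinearEquiv.mul_apply, key, h1, h2, hi, hj]
      try module
  · have : coxeterOrder (D.A i j * D.A j i) = 0 := by
      unfold coxeterOrder
      split_ifs <;> omega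
    rw [this, pow_zero]

/-- The Coxeter system of a reflection family. -/
noncomputable abbrev cs : CoxeterSystem D.coxeterMatrix D.coxeterMatrix.Group :=
  D.coxeterMatrix.toCoxeterSystem

/-- The action of the abstract Coxeter group by products of reflections. -/
noncomputable def rep : D.coxeterMatrix.Group →* (V ≃ₗ[ℝ] V) :=
  D.cs.lift ⟨D.refl, D.isLiftable_refl⟩

@[simp]
theorem rep_simple (i : ι) : D.rep (D.cs.simple i) = D.refl i :=
  D.cs.lift_apply_simple D.isLiftable_refl i

theorem range_rep : D.rep.range = Subgroup.closure (Set.range D.refl) := by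
  rw [MonoidHom.range_eq_map, ← D.cs.subgroup_closure_range_simple, MonoidHom.map_closure,
    ← Set.range_comp]
  congr 2

theorem rep_alternatingWord_coroot (i j : ι) (k : ℕ) :
    D.rep (D.cs.wordProd (CoxeterSystem.alternatingWord i j k)) (D.coroot i) =
      (alternatingCoeff (D.A i j) (D.A j i) k).1 • D.coroot i +
        (alternatingCoeff (D.A i j) (D.A j i) k).2 • D.coroot j := by
  induction k with
  | zero => simp [CoxeterSystem.alternatingWord, alternatingCoeff]
  | succ k ih =>
    rw [CoxeterSystem.alternatingWord_succ', CoxeterSystem.wordProd_cons, map_mul, rep_simple,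
      LinearEquiv.mul_apply, ih, D.refl_apply, alternatingCoeff]
    have hi := D.root_coroot_self i
    have hj := D.root_coroot_self j
    have h1 := D.root_coroot i j
    have h2 := D.root_coroot j i
    generalize (alternatingCoeff (D.A i j) (D.A j i) k).1 = p
    generalize (alternatingCoeff (D.A i j) (D.A j i) k).2 = q
    by_cases hke : Even k
    · simp only [hke, if_true, map_add, map_zsmul, h1, hj, zsmul_eq_mul]
      module
    · simp only [hke, if_false, map_add, map_zsmul, h2, hi, zsmul_eq_mul]
      module

/-- In the rank two subsystem of `i` and `j`, an alternating word ending with `j` that is shorter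
than the longest element sends the coroot of `i` to a positive coroot. -/
theorem exists_rep_alternatingWord_coroot {i j : ι} (hij : i ≠ j) (k : ℕ)
    (hk : D.coxeterMatrix i j = 0 ∨ k < D.coxeterMatrix i j) :
    ∃ p q : ℕ, D.rep (D.cs.wordProd (CoxeterSystem.alternatingWord i j k)) (D.coroot i) =
      p • D.coroot i + q • D.coroot j := by
  rw [D.coxeterMatrix_apply hij] at hk
  obtain ⟨hp, hq⟩ := alternatingCoeff_nonneg (D.isKacMoodyMatrix.off_diag i j hij)
    (D.isKacMoodyMatrix.off_diag j i (Ne.symm hij)) (D.isKacMoodyMatrix.zero_iff i j) k hk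
  obtain ⟨p, hp⟩ := Int.eq_ofNat_of_zero_le hp
  obtain ⟨q, hq⟩ := Int.eq_ofNat_of_zero_le hq
  exact ⟨p, q, by rw [D.rep_alternatingWord_coroot, hp, hq, natCast_zsmul, natCast_zsmul]⟩

/-- A Coxeter group element sends a simple coroot that is not a right descent to a positive
coroot. -/
theorem rep_coroot_mem_span (w : D.coxeterMatrix.Group) (i : ι) (hw : ¬ D.cs.IsRightDescent w i) :
    D.rep w (D.coroot i) ∈ Submodule.span ℕ (Set.range D.coroot) := by
  induction hn : D.cs.length w using Nat.strong_induction_on generalizing w i with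
  | _ n ih =>
  by_cases hw1 : w = 1
  · subst hw1
    rw [map_one]
    exact Submodule.subset_span ⟨i, rfl⟩
  obtain ⟨j, hj⟩ := D.cs.exists_rightDescent_of_ne_one hw1
  have hij : i ≠ j := by rintro rfl; exact hw hj
  rw [CoxeterSystem.isRightDescent_iff] at hj
  -- `P k`: a length-additive alternating suffix of length `k` ending in `j` splits off `w`. For
  -- maximal `k`, the cofactor `v` has neither `i` nor `j` as a right descent.
  let P : ℕ → Prop := fun k => 0 < k ∧ ∃ v, w = v * D.cs.wordProd
    (CoxeterSystem.alternatingWord i j k) ∧ D.cs.length v + k = D.cs.length w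
  classical
  have hP1 : P 1 := ⟨one_pos, w * D.cs.simple j, by
    rw [CoxeterSystem.alternatingWord, CoxeterSystem.alternatingWord, List.concat_nil,
      CoxeterSystem.wordProd_singleton, CoxeterSystem.simple_mul_simple_cancel_right], hj⟩
  have hPle : ∀ k, P k → k ≤ n := fun k ⟨_, v, _, h⟩ => by omega
  obtain ⟨k, ⟨hk0, v, hv, hlen⟩, hmax⟩ : ∃ k, P k ∧ ¬ P (k + 1) := by
    refine ⟨Nat.findGreatest P n, Nat.findGreatest_spec (hPle 1 hP1) hP1, fun h => ?_⟩
    have := Nat.le_findGreatest (hPle _ h) h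
    omega
  obtain ⟨k, rfl⟩ : ∃ k', k = k' + 1 := ⟨k - 1, by omega⟩
  have hd1 : ¬ D.cs.IsRightDescent v (if Even (k + 1) then j else i) := fun h => by
    rw [CoxeterSystem.isRightDescent_iff] at h
    refine hmax ⟨by omega, v * D.cs.simple (if Even (k + 1) then j else i), ?_, by omega⟩
    rw [CoxeterSystem.alternatingWord_succ', CoxeterSystem.wordProd_cons, ← mul_assoc,
      CoxeterSystem.simple_mul_simple_cancel_right, hv]
  -- This is the first letter of the suffix: if `v` also ended with it, the two would cancel and `w`
  -- would be too short.
  have hd2 : ¬ D.cs.IsRightDescent v (if Even k then j else i) := fun h => by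
    rw [CoxeterSystem.isRightDescent_iff] at h
    have h1 := D.cs.length_mul_le (v * D.cs.simple (if Even k then j else i))
      (D.cs.wordProd (CoxeterSystem.alternatingWord i j k))
    rw [mul_assoc, ← CoxeterSystem.wordProd_cons, ← CoxeterSystem.alternatingWord_succ',
      ← hv] at h1
    have h2 := D.cs.length_wordProd_le (CoxeterSystem.alternatingWord i j k)
    rw [CoxeterSystem.length_alternatingWord] at h2
    omega
  have hd : ¬ D.cs.IsRightDescent v i ∧ ¬ D.cs.IsRightDescent v j := by
    by_cases hke : Even k
    · simp only [hke, if_true, Nat.even_add_one, not_true, if_false] at hd1 hd2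
      exact ⟨hd1, hd2⟩
    · simp only [hke, if_false, Nat.even_add_one, not_false_iff, if_true] at hd1 hd2
      exact ⟨hd2, hd1⟩
  have hvi := ih _ (by omega) v i hd.1 rfl
  have hvj := ih _ (by omega) v j hd.2 rfl
  have hred : D.cs.IsReduced (CoxeterSystem.alternatingWord i j (k + 1)) := by
    have h1 := D.cs.length_mul_le v (D.cs.wordProd (CoxeterSystem.alternatingWord i j (k + 1)))
    rw [← hv] at h1
    have h2 := D.cs.length_wordProd_le (CoxeterSystem.alternatingWord i j (k + 1))
    rw [CoxeterSystem.length_alternatingWord] at h2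
    rw [CoxeterSystem.IsReduced, CoxeterSystem.length_alternatingWord]
    omega
  -- A suffix longer than the braid length is not reduced; one of exactly that length can be
  -- rewritten to end in `i`, contradicting `hw`.
  have hk : D.coxeterMatrix i j = 0 ∨ k + 1 < D.coxeterMatrix i j := by
    by_contra! hcon
    obtain ⟨hM, hle⟩ := hcon
    rcases hle.lt_or_eq with hlt | heq
    · exact D.cs.not_isReduced_alternatingWord i j hM hlt hred
    · apply hw
      have hb := D.cs.wordProd_braidWord_eq i j
      rw [CoxeterSystem.braidWord, CoxeterSystem.braidWord, ← D.coxeterMatrix.symmetric i j,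
        heq] at hb
      have h1 := D.cs.length_mul_le v (D.cs.wordProd (CoxeterSystem.alternatingWord i j k))
      have h2 := D.cs.length_wordProd_le (CoxeterSystem.alternatingWord i j k)
      rw [CoxeterSystem.length_alternatingWord] at h2
      have h3 : w * D.cs.simple i = v * D.cs.wordProd (CoxeterSystem.alternatingWord i j k) := by
        rw [hv, hb, CoxeterSystem.alternatingWord_succ, CoxeterSystem.wordProd_concat, mul_assoc,
          CoxeterSystem.simple_mul_simple_cancel_right]
      rw [CoxeterSystem.IsRightDescent, h3]
      omega
  obtain ⟨p, q, hpq⟩ := D.exists_rep_alternatingWord_coroot hij (k + 1) hk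
  rw [hv, map_mul, LinearEquiv.mul_apply, hpq, map_add, map_nsmul, map_nsmul]
  exact add_mem (nsmul_mem hvi p) (nsmul_mem hvj q)

/-! ### Weyl group, height and stabilizers of dominant points -/

/-- The group generated by the reflections of a family. -/
noncomputable def weyl : Subgroup (V ≃ₗ[ℝ] V) := Subgroup.closure (Set.range D.refl)

/-- The closed fundamental chamber. -/
def dominant : Set V := {v | ∀ i, 0 ≤ D.root i v}

/-- The points that can be moved into the closed fundamental chamber. -/
def tits : Set V := {v | ∃ w ∈ D.weyl, w v ∈ D.dominant}

/-- The reflections with index in a subset. -/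
def restrict (J : Set ι) : ReflectionFamily J V where
  A := D.A.submatrix (↑) (↑)
  isKacMoodyMatrix :=
    { diag := fun i => D.isKacMoodyMatrix.diag i
      off_diag := fun i j h => D.isKacMoodyMatrix.off_diag i j (Subtype.coe_injective.ne h)
      zero_iff := fun i j => D.isKacMoodyMatrix.zero_iff i j }
  root i := D.root i
  coroot i := D.coroot i
  root_coroot i j := D.root_coroot i j
  linearIndependent_coroot := D.linearIndependent_coroot.comp _ Subtype.coe_injective

theorem refl_mem_weyl (i : ι) : D.refl i ∈ D.weyl := Subgroup.subset_closure ⟨i, rfl⟩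

theorem weyl_restrict (J : Set ι) :
    (D.restrict J).weyl = Subgroup.closure (D.refl '' J) := by
  rw [weyl, Set.image_eq_range]
  rfl

theorem weyl_restrict_le (J : Set ι) : (D.restrict J).weyl ≤ D.weyl := by
  rw [weyl_restrict]
  exact Subgroup.closure_mono (Set.image_subset_range _ _)

theorem exists_rep_eq {w : V ≃ₗ[ℝ] V} (hw : w ∈ D.weyl) : ∃ g, D.rep g = w := by
  rwa [weyl, ← range_rep] at hw

/-- There is a linear form with value one on every coroot. -/
theorem exists_height : ∃ f : V →ₗ[ℝ] ℝ, ∀ i, f (D.coroot i) = 1 := by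
  obtain ⟨g, hg⟩ := LinearMap.exists_leftInverse_of_injective
    (Finsupp.linearCombination ℝ D.coroot) (LinearMap.ker_eq_bot.2 D.linearIndependent_coroot)
  refine ⟨(Finsupp.linearCombination ℝ fun _ : ι => (1 : ℝ)) ∘ₗ g, fun i => ?_⟩
  have := LinearMap.congr_fun hg (Finsupp.single i 1)
  simp only [LinearMap.comp_apply, Finsupp.linearCombination_single, one_smul,
    LinearMap.id_apply] at this
  simp [this]

/-- A chosen linear form with value one on every coroot. -/
noncomputable def height : V →ₗ[ℝ] ℝ := D.exists_height.choose

@[simp]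
theorem height_coroot (i : ι) : D.height (D.coroot i) = 1 := D.exists_height.choose_spec i

theorem height_refl (i : ι) (v : V) : D.height (D.refl i v) = D.height v - D.root i v := by
  simp [D.refl_apply]

/-- Every element of the Weyl group moves a point `v` by a combination of coroots with coefficients
that are natural multiples of the values of the roots at `v`. -/
theorem exists_rep_eq_sub_sum [Fintype ι] (w : D.coxeterMatrix.Group) :
    ∃ n : ι → ι → ℕ, ∀ v, D.rep w v = v - ∑ i, D.root i v • ∑ j, n i j • D.coroot j := by
  classical
  induction hn : D.cs.length w using Nat.strong_induction_on generalizing w with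
  | _ m ih =>
  by_cases hw1 : w = 1
  · exact ⟨0, by simp [hw1]⟩
  obtain ⟨j, hj⟩ := D.cs.exists_rightDescent_of_ne_one hw1
  have hj' := D.cs.isRightDescent_iff_not_isRightDescent_mul.1 hj
  rw [CoxeterSystem.isRightDescent_iff] at hj
  obtain ⟨n, hn⟩ := ih _ (by omega) (w * D.cs.simple j) rfl
  obtain ⟨c, hc⟩ := (Submodule.mem_span_range_iff_exists_fun ℕ).1 (D.rep_coroot_mem_span _ _ hj')
  -- Passing from `w s_j` to `w` subtracts `α_j(v)` times the positive coroot `w s_j(α_j^∨)`, so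
  -- only row `j` changes.
  refine ⟨n + Pi.single j c, fun v => ?_⟩
  have hw : D.rep w v = D.rep (w * D.cs.simple j) (D.refl j v) := by
    rw [← rep_simple, ← LinearEquiv.mul_apply, ← map_mul,
      CoxeterSystem.simple_mul_simple_cancel_right]
  have hs : ∑ i, D.root i v • ∑ l, (Pi.single j c : ι → ι → ℕ) i l • D.coroot l =
      D.root j v • ∑ l, c l • D.coroot l := by
    rw [Finset.sum_eq_single j]
    · simp
    · intro b _ hb
      simp [Pi.single_eq_of_ne hb]
    · simp
  rw [hw, D.refl_apply, map_sub, map_smul, hn, ← hc]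
  simp only [Pi.add_apply, add_smul, Finset.sum_add_distrib, smul_add, hs]
  abel

theorem exists_height_rep [Fintype ι] (w : D.coxeterMatrix.Group) :
    ∃ n : ι → ℕ, ∀ v, D.height (D.rep w v) = D.height v - ∑ i, D.root i v * n i := by
  obtain ⟨n, hn⟩ := D.exists_rep_eq_sub_sum w
  exact ⟨fun i => ∑ j, n i j, fun v => by simp [hn]⟩

theorem height_le_of_mem_dominant [Fintype ι] {w : V ≃ₗ[ℝ] V} (hw : w ∈ D.weyl) {v : V}
    (hv : v ∈ D.dominant) : D.height (w v) ≤ D.height v := by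
  obtain ⟨g, rfl⟩ := D.exists_rep_eq hw
  obtain ⟨n, hn⟩ := D.exists_height_rep g
  rw [hn]
  have : 0 ≤ ∑ i, D.root i v * n i :=
    Finset.sum_nonneg fun i _ => mul_nonneg (hv i) (Nat.cast_nonneg _)
  linarith

theorem height_pos_of_mem_span {v : V} (hv : v ∈ Submodule.span ℕ (Set.range D.coroot))
    (h0 : v ≠ 0) [Fintype ι] : 0 < D.height v := by
  obtain ⟨c, rfl⟩ := (Submodule.mem_span_range_iff_exists_fun ℕ).1 hv
  simp only [map_sum, map_nsmul, height_coroot, nsmul_eq_mul, mul_one]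
  obtain ⟨i, -, hi⟩ := Finset.exists_ne_zero_of_sum_ne_zero h0
  have hci : c i ≠ 0 := fun h => hi (by simp [h])
  exact Finset.sum_pos' (fun i _ => Nat.cast_nonneg _)
    ⟨i, Finset.mem_univ i, Nat.cast_pos.2 (Nat.pos_of_ne_zero hci)⟩

/-- The stabilizer of a dominant point is generated by the simple reflections that fix it. -/
theorem mem_weyl_restrict_of_apply_eq [Finite ι] {w : V ≃ₗ[ℝ] V} (hw : w ∈ D.weyl) {v : V}
    (hv : v ∈ D.dominant) (h : w v = v) : w ∈ (D.restrict {i | D.root i v = 0}).weyl := by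
  cases nonempty_fintype ι
  obtain ⟨g, rfl⟩ := D.exists_rep_eq hw
  clear hw
  rw [weyl_restrict]
  induction hn : D.cs.length g using Nat.strong_induction_on generalizing g with
  | _ m ih =>
  by_cases hw1 : g = 1
  · rw [hw1, map_one]
    exact one_mem _
  obtain ⟨j, hj⟩ := D.cs.exists_rightDescent_of_ne_one hw1
  have hj' := D.cs.isRightDescent_iff_not_isRightDescent_mul.1 hj
  rw [CoxeterSystem.isRightDescent_iff] at hj
  have hg : D.rep g = D.rep (g * D.cs.simple j) * D.refl j := by
    rw [← rep_simple, ← map_mul, CoxeterSystem.simple_mul_simple_cancel_right]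
  have hpos := D.height_pos_of_mem_span (D.rep_coroot_mem_span _ _ hj') (by
    rw [ne_eq, LinearEquiv.map_eq_zero_iff]
    exact D.linearIndependent_coroot.ne_zero j)
  have hle := D.height_le_of_mem_dominant
    (w := D.rep (g * D.cs.simple j)) (by rw [weyl, ← range_rep]; exact ⟨_, rfl⟩) hv
  have h' := h
  rw [hg, LinearEquiv.mul_apply, D.refl_apply, map_sub, map_smul] at h'
  -- The height cannot rise under `w s_j`, so it returns to its initial value only if the
  -- nonnegative loss at `s_j` vanishes.
  have h0 : D.root j v = 0 := by
    have h1 := congrArg D.height h'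
    rw [map_sub, map_smul, smul_eq_mul] at h1
    have h2 := mul_nonneg (hv j) hpos.le
    have h3 : D.root j v * D.height (D.rep (g * D.cs.simple j) (D.coroot j)) = 0 := by linarith
    exact (mul_eq_zero.1 h3).resolve_right hpos.ne'
  rw [hg]
  refine mul_mem (ih _ (by omega) _ ?_ rfl) (Subgroup.subset_closure ⟨j, h0, rfl⟩)
  rwa [h0, zero_smul, sub_zero] at h'

/-- A point of maximal height in an orbit is dominant. -/
theorem mem_dominant_of_forall_height_le {H : Subgroup (V ≃ₗ[ℝ] V)} {u : V ≃ₗ[ℝ] V} (hu : u ∈ H)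
    {v : V} (h : ∀ w ∈ H, D.height (w v) ≤ D.height (u v)) {i : ι} (hi : D.refl i ∈ H) :
    0 ≤ D.root i (u v) := by
  have := h _ (mul_mem hi hu)
  rw [LinearEquiv.mul_apply, height_refl] at this
  linarith

/-! ### Maximal heights and the Tits cone -/

/-- The height has a maximum on the orbit of a conical combination of two points of the Tits cone
under any subgroup of the Weyl group. -/
theorem exists_forall_height_le [Finite ι] {H : Subgroup (V ≃ₗ[ℝ] V)} (hH : H ≤ D.weyl) {x y : V}
    (hx : x ∈ D.tits) (hy : y ∈ D.tits) {s t : ℝ} (hs : 0 ≤ s) (ht : 0 ≤ t) :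
    ∃ u ∈ H, ∀ w ∈ H, D.height (w (s • x + t • y)) ≤ D.height (u (s • x + t • y)) := by
  cases nonempty_fintype ι
  obtain ⟨a, ha, hxa⟩ := hx
  obtain ⟨b, hb, hyb⟩ := hy
  let F : (ι → ℕ) × (ι → ℕ) → ℝ := fun n =>
    s * ∑ i, D.root i (a x) * n.1 i + t * ∑ i, D.root i (b y) * n.2 i
  have hF : Monotone F := fun m n hmn => by
    refine add_le_add (mul_le_mul_of_nonneg_left (Finset.sum_le_sum fun i _ => ?_) hs)
      (mul_le_mul_of_nonneg_left (Finset.sum_le_sum fun i _ => ?_) ht)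
    · exact mul_le_mul_of_nonneg_left (Nat.cast_le.2 (hmn.1 i)) (hxa i)
    · exact mul_le_mul_of_nonneg_left (Nat.cast_le.2 (hmn.2 i)) (hyb i)
  have key : ∀ w ∈ D.weyl, ∃ n, D.height (w (s • x + t • y)) =
      s * D.height (a x) + t * D.height (b y) - F n := by
    intro w hw
    obtain ⟨g, hg⟩ := D.exists_rep_eq (mul_mem hw (inv_mem ha))
    obtain ⟨g', hg'⟩ := D.exists_rep_eq (mul_mem hw (inv_mem hb))
    obtain ⟨m, hm⟩ := D.exists_height_rep g
    obtain ⟨m', hm'⟩ := D.exists_height_rep g'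
    refine ⟨(m, m'), ?_⟩
    have e1 : w x = D.rep g (a x) := by
      rw [hg, ← LinearEquiv.mul_apply, inv_mul_cancel_right]
    have e2 : w y = D.rep g' (b y) := by
      rw [hg', ← LinearEquiv.mul_apply, inv_mul_cancel_right]
    simp only [map_add, map_smul, e1, e2, hm, hm', smul_eq_mul, F]
    ring
  -- Dickson's lemma: `ℕ^ι × ℕ^ι` is well quasi-ordered, so the values of the monotone `F` are
  -- partially well-ordered and the height loss attains a minimum.
  have hpwo : ((fun w : V ≃ₗ[ℝ] V => s * D.height (a x) + t * D.height (b y) -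
      D.height (w (s • x + t • y))) '' (H : Set (V ≃ₗ[ℝ] V))).IsPWO := by
    refine ((Set.isPWO_of_wellQuasiOrderedLE Set.univ).image_of_monotone hF).mono ?_
    rintro _ ⟨w, hw, rfl⟩
    obtain ⟨n, hn⟩ := key w (hH hw)
    exact ⟨n, trivial, by simp only [hn]; ring⟩
  obtain ⟨u, hu, hmin⟩ := Set.IsPWO.exists_minimalFor _ _ hpwo ⟨1, one_mem H⟩
  refine ⟨u, hu, fun w hw => ?_⟩
  by_contra! hlt
  have := hmin hw (by simp only; linarith)
  simp only at this
  linarith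

/-- The Tits cone is stable under conical combinations. -/
theorem smul_add_smul_mem_tits [Finite ι] {x y : V} (hx : x ∈ D.tits) (hy : y ∈ D.tits) {s t : ℝ}
    (hs : 0 ≤ s) (ht : 0 ≤ t) : s • x + t • y ∈ D.tits := by
  obtain ⟨u, hu, h⟩ := D.exists_forall_height_le le_rfl hx hy hs ht
  exact ⟨u, hu, fun i => D.mem_dominant_of_forall_height_le hu h (D.refl_mem_weyl i)⟩

/-- The Tits cone is contained in the Tits cone of a subfamily. -/
theorem tits_subset_tits_restrict [Finite ι] (J : Set ι) : D.tits ⊆ (D.restrict J).tits := by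
  intro x hx
  obtain ⟨u, hu, h⟩ := D.exists_forall_height_le (D.weyl_restrict_le J) hx hx zero_le_one le_rfl
  simp only [one_smul, zero_smul, add_zero] at h
  exact ⟨u, hu, fun i =>
    D.mem_dominant_of_forall_height_le hu h ((D.restrict J).refl_mem_weyl i)⟩

theorem apply_mem_tits {w : V ≃ₗ[ℝ] V} (hw : w ∈ D.weyl) {x : V} (hx : x ∈ D.tits) :
    w x ∈ D.tits := by
  obtain ⟨a, ha, hxa⟩ := hx
  refine ⟨a * w⁻¹, mul_mem ha (inv_mem hw), ?_⟩
  rwa [← LinearEquiv.mul_apply, inv_mul_cancel_right]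

theorem apply_eq_of_mem_weyl {v : V} (hv : ∀ i, D.root i v = 0) {w : V ≃ₗ[ℝ] V}
    (hw : w ∈ D.weyl) : w v = v := by
  induction hw using Subgroup.closure_induction with
  | mem w hw =>
    obtain ⟨i, rfl⟩ := hw
    rw [refl_apply, hv, zero_smul, sub_zero]
  | one => rfl
  | mul a b _ _ ha hb => rw [LinearEquiv.mul_apply, hb, ha]
  | inv a _ ha => exact (LinearEquiv.symm_apply_eq a).2 ha.symm

/-! ### Finite orbits and extension of segments -/

/-- In a segment of the Tits cone through a fixed point of the Weyl group, the orbits of the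
endpoints are finite. -/
theorem finite_orbit_of_mem_openSegment [Finite ι] {x y v : V} (hx : x ∈ D.tits)
    (hy : y ∈ D.tits) (hv : v ∈ openSegment ℝ x y) (hfix : ∀ i, D.root i v = 0) :
    {z | ∃ w ∈ D.weyl, w x = z}.Finite := by
  cases nonempty_fintype ι
  obtain ⟨a, ha, hxa⟩ := hx
  obtain ⟨b, hb, hyb⟩ := hy
  obtain ⟨s, t, hs, ht, -, rfl⟩ := hv
  set v := s • x + t • y with hv
  -- Since `w` fixes `v`, a low `w x` would force a high `w y`, but `w y` is never higher than the
  -- dominant point `b y`.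
  have hlow : ∀ w ∈ D.weyl, (D.height v - t * D.height (b y)) / s ≤ D.height (w x) := by
    intro w hw
    have h1 := congrArg D.height (D.apply_eq_of_mem_weyl hfix hw)
    have h2 := D.height_le_of_mem_dominant (mul_mem hw (inv_mem hb)) hyb
    rw [← LinearEquiv.mul_apply, inv_mul_cancel_right] at h2
    nth_rw 1 [hv] at h1
    simp only [map_add, map_smul, smul_eq_mul] at h1
    rw [div_le_iff₀ hs]
    nlinarith
  set K := D.height (a x) - (D.height v - t * D.height (b y)) / s with hK
  let N : ι → ι → ℕ := fun i _ => ⌊K / D.root i (a x)⌋₊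
  classical
  refine ((Set.finite_Icc (0 : ι → ι → ℕ) N).image fun n =>
    a x - ∑ i, D.root i (a x) • ∑ j, n i j • D.coroot j).subset ?_
  rintro _ ⟨w, hw, rfl⟩
  obtain ⟨g, hg⟩ := D.exists_rep_eq (mul_mem hw (inv_mem ha))
  obtain ⟨n, hn⟩ := D.exists_rep_eq_sub_sum g
  have hwx : w x = a x - ∑ i, D.root i (a x) • ∑ j, n i j • D.coroot j := by
    rw [← hn, hg, ← LinearEquiv.mul_apply, inv_mul_cancel_right]
  have hbound : ∑ i, D.root i (a x) * ∑ j, (n i j : ℝ) ≤ K := by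
    have h1 := hlow w hw
    rw [hwx] at h1
    simp only [map_sub, map_sum, map_smul, map_nsmul, height_coroot, smul_eq_mul, nsmul_eq_mul,
      mul_one] at h1
    linarith
  -- Rows with `α_i(a x) = 0` are not bounded by the height but do not affect the point, so they are
  -- replaced by 0.
  refine ⟨fun i j => if D.root i (a x) = 0 then 0 else n i j,
    ⟨fun i j => Nat.zero_le _, fun i j => ?_⟩, ?_⟩
  · by_cases h0 : D.root i (a x) = 0
    · simp [h0]
    · have hpos := (hxa i).lt_of_ne' h0
      simp only [h0, if_false, N]
      refine Nat.le_floor ((le_div_iff₀ hpos).2 (le_trans ?_ hbound))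
      refine le_trans ?_ (Finset.single_le_sum (f := fun i => D.root i (a x) * ∑ j, (n i j : ℝ))
        (fun i _ => mul_nonneg (hxa i) (Finset.sum_nonneg fun _ _ => Nat.cast_nonneg _))
        (Finset.mem_univ i))
      rw [mul_comm]
      refine mul_le_mul_of_nonneg_left ?_ hpos.le
      exact Finset.single_le_sum (f := fun j => (n i j : ℝ)) (fun _ _ => Nat.cast_nonneg _)
        (Finset.mem_univ j)
  · rw [hwx]
    refine congrArg _ (Finset.sum_congr rfl fun i _ => ?_)
    by_cases h0 : D.root i (a x) = 0 <;> simp [h0]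

/-- For an interior point `v` of a segment of the Tits cone, the orbits of the endpoints under the
stabilizer of `v` are finite. -/
theorem finite_stabilizer_orbit [Finite ι] {x y v : V} (hx : x ∈ D.tits) (hy : y ∈ D.tits)
    (hv : v ∈ openSegment ℝ x y) : {z | ∃ w ∈ D.weyl, w v = v ∧ w x = z}.Finite := by
  obtain ⟨g, hg, hgv⟩ : v ∈ D.tits := by
    obtain ⟨s, t, hs, ht, -, rfl⟩ := hv
    exact D.smul_add_smul_mem_tits hx hy hs.le ht.le
  have hseg : g v ∈ openSegment ℝ (g x) (g y) := by
    obtain ⟨s, t, hs, ht, hst, rfl⟩ := hv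
    exact ⟨s, t, hs, ht, hst, by simp⟩
  have hfin := (D.restrict {i | D.root i (g v) = 0}).finite_orbit_of_mem_openSegment
    (D.tits_subset_tits_restrict _ (D.apply_mem_tits hg hx))
    (D.tits_subset_tits_restrict _ (D.apply_mem_tits hg hy)) hseg (fun i => i.2)
  refine (hfin.image g.symm).subset ?_
  rintro _ ⟨w, hw, hwv, rfl⟩
  refine ⟨g (w x), ⟨g * w * g⁻¹, D.mem_weyl_restrict_of_apply_eq
    (mul_mem (mul_mem hg hw) (inv_mem hg)) hgv ?_, ?_⟩, by simp⟩
  · rw [← LinearEquiv.mul_apply, inv_mul_cancel_right, LinearEquiv.mul_apply, hwv]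
  · rw [← LinearEquiv.mul_apply, inv_mul_cancel_right, LinearEquiv.mul_apply]

/-- If the orbit of `x` under the stabilizer of a point `v` of the Tits cone is finite, then the
segment from `x` to `v` can be extended beyond `v` in the Tits cone. -/
theorem exists_mem_openSegment [Finite ι] {x v : V} (hv : v ∈ D.tits)
    (hfin : {z | ∃ w ∈ D.weyl, w v = v ∧ w x = z}.Finite) :
    ∃ y ∈ D.tits, v ∈ openSegment ℝ x y := by
  obtain ⟨g, hg, hgv⟩ := hv
  let H : Subgroup (V ≃ₗ[ℝ] V) := D.weyl ⊓ MulAction.stabilizer (V ≃ₗ[ℝ] V) (g v)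
  have hmem : ∀ w, w ∈ H ↔ w ∈ D.weyl ∧ w (g v) = g v := fun w => Iff.rfl
  have hHfin : ((fun w : V ≃ₗ[ℝ] V => w (g x)) '' (H : Set (V ≃ₗ[ℝ] V))).Finite := by
    refine (hfin.image g).subset ?_
    rintro _ ⟨w, hw, rfl⟩
    obtain ⟨hw, hwv⟩ := (hmem w).1 hw
    refine ⟨g.symm (w (g x)), ⟨g⁻¹ * w * g, mul_mem (mul_mem (inv_mem hg) hw) hg, ?_, rfl⟩, by simp⟩
    change g.symm (w (g v)) = v
    rw [hwv, LinearEquiv.symm_apply_apply]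
  -- The sign makes `-u(g x)`, rather than `u(g x)`, nonnegative on the roots vanishing at `g v`;
  -- `-x` itself need not lie in the Tits cone.
  obtain ⟨_, ⟨u, hu, rfl⟩, hmax⟩ := Set.exists_max_image _ (fun z => D.height (-z)) hHfin
    ⟨_, 1, one_mem H, rfl⟩
  have hdom : ∀ i, D.root i (g v) = 0 → 0 ≤ D.root i (u (-g x)) := fun i hi => by
    refine D.mem_dominant_of_forall_height_le hu (fun w hw => ?_) ((hmem _).2
      ⟨D.refl_mem_weyl i, by rw [refl_apply, hi, zero_smul, sub_zero]⟩)
    simpa using hmax _ ⟨w, hw, rfl⟩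
  obtain ⟨huW, huv⟩ := (hmem u).1 hu
  have hev : ∀ i, ∀ᶠ e : ℝ in nhdsWithin 0 (Set.Ioi 0),
      0 ≤ D.root i ((1 + e) • g v + e • u (-g x)) := by
    intro i
    rcases (hgv i).eq_or_lt with h0 | hpos
    · filter_upwards [self_mem_nhdsWithin] with e he
      simp only [map_add, map_smul, ← h0, smul_eq_mul, mul_zero, zero_add]
      exact mul_nonneg (Set.mem_Ioi.1 he).le (hdom i h0.symm)
    · have hc : Continuous fun e : ℝ =>
          (1 + e) * D.root i (g v) + e * D.root i (u (-g x)) := by fun_prop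
      have ht := hc.tendsto 0
      simp only [add_zero, one_mul, zero_mul] at ht
      filter_upwards [(ht.mono_left nhdsWithin_le_nhds).eventually (lt_mem_nhds hpos)] with e he
      simpa only [map_add, map_smul, smul_eq_mul] using he.le
  obtain ⟨e, he, he0⟩ := ((Filter.eventually_all.2 hev).and self_mem_nhdsWithin).exists
  have he0 : 0 < e := he0
  -- The endpoint is `v + e(v - x)`, slightly beyond `v` on the line from `x`.
  refine ⟨(1 + e) • v - e • x, ⟨u * g, mul_mem huW hg, fun i => ?_⟩, ?_⟩
  · convert he i using 2
    rw [LinearEquiv.mul_apply, map_sub, map_sub, map_smul, map_smul, map_smul, map_smul, huv,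
      map_neg, smul_neg, sub_eq_add_neg]
  · refine ⟨e / (1 + e), 1 / (1 + e), by positivity, by positivity, by field_simp; ring, ?_⟩
    rw [smul_sub, smul_smul, smul_smul, one_div_mul_cancel (by positivity), one_smul,
      one_div_mul_eq_div]
    abel

end ReflectionFamily

/-! ### Return to root data: quotients as orbits, and counting -/

namespace KacMoodyRootDatum

variable {I X Y : Type*} [Finite I]
  [AddCommGroup X] [Module.Free ℤ X] [Module.Finite ℤ X]
  [AddCommGroup Y] [Module.Free ℤ Y] [Module.Finite ℤ Y]
  (S : KacMoodyRootDatum I X Y)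

/-- The simple reflections of a Kac-Moody root datum as a reflection family. -/
noncomputable def reflectionFamily : ReflectionFamily I S.Apartment where
  A := S.A
  isKacMoodyMatrix := S.isKacMoodyMatrix
  root := S.simpleRoot
  coroot := S.simpleCoroot
  root_coroot i j := by
    simp [simpleRoot, simpleCoroot, form_tmul, S.pairing_root_coroot]
  linearIndependent_coroot :=
    Module.Flat.linearIndependent_one_tmul (S := ℝ) S.linearIndependent_coroot

theorem tits_reflectionFamily : S.reflectionFamily.tits = S.titsCone := by
  ext v
  simp only [ReflectionFamily.tits, titsCone, Set.mem_ofPred_eq, Set.mem_iUnion, Set.mem_image]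
  constructor
  · rintro ⟨w, hw, hv⟩
    exact ⟨⟨w⁻¹, inv_mem hw⟩, w v, hv, w.symm_apply_apply v⟩
  · rintro ⟨w, u, hu, rfl⟩
    refine ⟨w⁻¹, inv_mem w.2, ?_⟩
    have : (w⁻¹ : S.Apartment ≃ₗ[ℝ] S.Apartment) (w • u) = u :=
      (w : S.Apartment ≃ₗ[ℝ] S.Apartment).symm_apply_apply u
    rw [this]
    exact hu

/-- The quotient of the fixator of a point by the fixator of two points is an orbit. -/
noncomputable def fixatorQuotientEquiv (x v : S.Apartment) :
    (S.fixator {v} ⧸ (S.fixator {x} ⊓ S.fixator {v}).subgroupOf (S.fixator {v})) ≃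
      MulAction.orbit (S.fixator {v}) x :=
  (Subgroup.quotientEquivOfEq (by
    ext w
    simp only [Subgroup.mem_subgroupOf, Subgroup.mem_inf, SetLike.coe_mem, and_true,
      mem_fixator, Set.mem_singleton_iff, forall_eq, MulAction.mem_stabilizer_iff]
    rfl)).trans (MulAction.orbitEquivQuotientStabilizer (S.fixator {v}) x).symm

theorem coe_orbit_fixator (x v : S.Apartment) :
    MulAction.orbit (S.fixator {v}) x =
      {z | ∃ w ∈ S.reflectionFamily.weyl, w v = v ∧ w x = z} := by
  ext z
  constructor
  · rintro ⟨w, rfl⟩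
    exact ⟨w, w.1.2, (S.mem_fixator _ _).1 w.2 v rfl, rfl⟩
  · rintro ⟨w, hw, hwv, rfl⟩
    refine ⟨⟨⟨w, hw⟩, (S.mem_fixator _ _).2 ?_⟩, rfl⟩
    rintro _ rfl
    exact hwv

/-- The fixator of a segment is the fixator of an endpoint and of an interior point. -/
theorem fixator_segment {x y v : S.Apartment} (hv : v ∈ openSegment ℝ x y) :
    S.fixator (segment ℝ x y) = S.fixator {x} ⊓ S.fixator {v} := by
  ext w
  simp only [Subgroup.mem_inf, mem_fixator, Set.mem_singleton_iff, forall_eq]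
  constructor
  · exact fun h => ⟨h _ (left_mem_segment ℝ x y), h _ (openSegment_subset_segment ℝ x y hv)⟩
  · rintro ⟨hx, hwv⟩
    obtain ⟨s, t, -, ht, -, rfl⟩ := hv
    rw [map_add, map_smul, map_smul, hx, add_right_inj] at hwv
    have hy := smul_right_injective _ ht.ne' hwv
    rintro _ ⟨a, b, -, -, -, rfl⟩
    rw [map_add, map_smul, map_smul, hx, hy]

/-- A set of Weyl group elements with finitely many images of `v` has at most as many images of
`x` as allowed by the orbit of `x` under the fixator of `v`. -/
theorem finite_image_and_ncard_le {x v : S.Apartment} {E : Set S.weylGroup}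
    (hE : ((fun w => w • v) '' E).Finite) (hfin : (MulAction.orbit (S.fixator {v}) x).Finite) :
    ((fun w => w • x) '' E).Finite ∧ ((fun w => w • x) '' E).ncard ≤
      ((fun w => w • v) '' E).ncard * (MulAction.orbit (S.fixator {v}) x).ncard := by
  classical
  -- A chosen representative `g z` for each `z` in the orbit of `v` writes `w x` as `g(w v)` applied
  -- to a point of the orbit of `x` under the fixator of `v`.
  let g : S.Apartment → S.weylGroup := fun z =>
    if h : ∃ w, w • v = z then h.choose else 1
  have hg : ∀ w : S.weylGroup, g (w • v) • v = w • v := fun w => by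
    have h : ∃ u : S.weylGroup, u • v = w • v := ⟨w, rfl⟩
    simp only [g, dif_pos h]
    exact h.choose_spec
  have hsub : (fun w => w • x) '' E ⊆ (fun p : S.Apartment × S.Apartment => g p.1 • p.2) ''
      (((fun w => w • v) '' E) ×ˢ MulAction.orbit (S.fixator {v}) x) := by
    rintro _ ⟨w, hw, rfl⟩
    refine ⟨(w • v, (g (w • v))⁻¹ • w • x), ⟨⟨w, hw, rfl⟩, ?_⟩, smul_inv_smul _ _⟩
    refine ⟨⟨(g (w • v))⁻¹ * w, (S.mem_fixator _ _).2 ?_⟩, mul_smul (g (w • v))⁻¹ w x⟩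
    intro u hu
    rw [Set.mem_singleton_iff.1 hu]
    change ((g (w • v))⁻¹ * w) • v = v
    rw [mul_smul, inv_smul_eq_iff, hg]
  have hprod := hE.prod hfin
  refine ⟨(hprod.image _).subset hsub, ?_⟩
  rw [← Set.ncard_prod]
  exact (Set.ncard_le_ncard hsub (hprod.image _)).trans (Set.ncard_image_le hprod)

end KacMoodyRootDatum

theorem mainTheorem7 {I X Y : Type*} [Finite I]
    [AddCommGroup X] [Module.Free ℤ X] [Module.Finite ℤ X]
    [AddCommGroup Y] [Module.Free ℤ Y] [Module.Finite ℤ Y]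
    (S : KacMoodyRootDatum I X Y) :
    (∀ lam ∈ S.titsCone, ∀ nu ∈ S.titsCone, lam ≠ nu →
      (Finite (S.fixator {nu} ⧸ (S.fixator {lam} ⊓ S.fixator {nu}).subgroupOf (S.fixator {nu})) ↔
        ∃ lam' ∈ S.titsCone, nu ∈ openSegment ℝ lam lam')) ∧
    (∀ lam ∈ S.titsCone, ∀ lam' ∈ S.titsCone, lam ≠ lam' → ∀ nu ∈ openSegment ℝ lam lam',
      ∀ E : Set S.weylGroup, ((fun w => w • nu) '' E).Finite →
        Finite (S.fixator {nu} ⧸ (S.fixator (segment ℝ lam lam')).subgroupOf (S.fixator {nu})) ∧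
        ((fun w => w • lam) '' E).Finite ∧
        ((fun w => w • lam) '' E).ncard ≤ ((fun w => w • nu) '' E).ncard *
          Nat.card
            (S.fixator {nu} ⧸ (S.fixator (segment ℝ lam lam')).subgroupOf (S.fixator {nu}))) := by
  rw [← S.tits_reflectionFamily]
  refine ⟨fun lam hlam nu hnu _ => ?_, fun lam hlam lam' hlam' _ nu hseg E hE => ?_⟩
  · rw [(S.fixatorQuotientEquiv lam nu).finite_iff, Set.finite_coe_iff, S.coe_orbit_fixator]
    refine ⟨fun h => S.reflectionFamily.exists_mem_openSegment hnu h, ?_⟩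
    rintro ⟨lam', hlam', hseg⟩
    exact S.reflectionFamily.finite_stabilizer_orbit hlam hlam' hseg
  · have hfin : (MulAction.orbit (S.fixator {nu}) lam).Finite := by
      rw [S.coe_orbit_fixator]
      exact S.reflectionFamily.finite_stabilizer_orbit hlam hlam' hseg
    rw [S.fixator_segment hseg, Nat.card_congr (S.fixatorQuotientEquiv lam nu),
      (S.fixatorQuotientEquiv lam nu).finite_iff, Set.finite_coe_iff, Nat.card_coe_set_eq]
    exact ⟨hfin, S.finite_image_and_ncard_le hE hfin⟩
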